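/- A semi-Markovian graph (SMG) is a finite graph $G$ on observed vertices $\mathbf V$ with directed edges forming no directed cycle and with bidirected edges $A\leftrightarrow B$ ($A\ne B$), each standing for an unobserved common parent of $A$ and $B$. $An(\mathbf Y)_G$ is the set of ancestors of $\mathbf Y$, including $\mathbf Y$; $G[\mathbf A]$ is the subgraph induced by $\mathbf A$, with its directed and bidirected edges. For $\mathbf A\subseteq\mathbf V$ the latent projection $L(G,\mathbf A)$ is the SMG on $\mathbf A$ in which, for distinct $Z,T\in\mathbf A$: $Z\to T$ iff there is a directed path from $Z$ to $T$ in $G$ whose intermediate vertices are all latent (outside $\mathbf A$, or unobserved); $Z\leftrightarrow T$ iff there is a path between $Z$ and $T$ without colliders whose intermediate vertices are all latent and whose first and last edges point into $Z$ and into $T$ respectively. A causal model with graph $G$ consists of mutually independent unobserved random variables $\mathbf U$ and, for every $V\in\mathbf V$, a measurable function giving the value of $V$ (in a countable set) from the values of the parents of $V$ in $G$ and of some of the variables in $\mathbf U$, where two distinct observed variables may share an argument in $\mathbf U$ only if they are joined by a bidirected edge. (Semi-Markovian models, in which each $U\in\mathbf U$ occurs in at most two functions, are a special case. Functions may ignore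 some of their arguments.) $P(\mathbf V)$ is the joint distribution of $\mathbf V$ in the model, and $P_{x}(\mathbf y)$ is the probability of $\mathbf Y=\mathbf y$ after the function of $X$ has been replaced by the constant $x$. For a joint distribution $Q$ of the vertices of $G$ induced by some model with graph $G$, the number $q$ is the value of the causal effect obtained from $Q$ in $G$ if $P_x(\mathbf y)=q$ in every model with graph $G$ whose joint distribution is $Q$. **Statement.** Let $G$ be an SMG with vertex set $\mathbf V$, let $\mathbf Y\subseteq\mathbf V$, and let $X\neq W$ with $X,W\in An(\mathbf Y)_G$ and $W\notin\mathbf Y$. Let $G'=L\bigl(G[An(\mathbf Y)_G],\,An(\mathbf Y)_G\setminus\{W\}\bigr)$, and suppose that in $G'$ there is no path consisting of bidirected edges from $X$ to any child of $X$ (other than $X$ itself). Let $x$ and $\mathbf y$ be values of $X$ and $\mathbf Y$. Then: 1. the causal effect of $x$ on $\mathbf y$ is identifiable in $G'$: any two models with graph $G'$ that have the same strictly positive joint distribution have the same $P_x(\mathbf y)$; 2. for every model with graph $G$ and joint distribution $P$ for which the marginal $P'=P(An(\mathbf Y)_G\setminus\{W\})$ is strictly positive, $P'$ is the joint distribution of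 some model with graph $G'$, and the causal effect $P_x(\mathbf y)$ obtained from $P$ in $G$ and the causal effect $P'_x(\mathbf y)$ obtained from $P'$ in $G'$ both exist and are equal, their common value being $P_x(\mathbf y)$ in the given model. -/

import Mathlib

open MeasureTheory ProbabilityTheory

universe u v w

/-- A semi-Markovian graph: a finite set `verts` of observed vertices, directed edges
`dir a b` (that is `a → b`) without directed cycles, and bidirected edges `bidir a b`
(that is `a ↔ b`), each standing for an unobserved common parent of `a` and `b`. -/
structure SMG (α : Type u) where
  verts : Set α
  finite_verts : verts.Finite
  dir : α → α → Prop
  bidir : α → α → Prop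
  dir_mem : ∀ a b, dir a b → a ∈ verts ∧ b ∈ verts
  bidir_mem : ∀ a b, bidir a b → a ∈ verts ∧ b ∈ verts
  bidir_symm : ∀ a b, bidir a b → bidir b a
  bidir_irrefl : ∀ a, ¬ bidir a a
  acyclic : ∀ a, ¬ Relation.TransGen dir a a

section Paths

variable {N : Type u}

/-- There is a directed path `z → ⋯ → t` of positive length, for the edge relation `E`,
on which every vertex except `z` and `t` is latent, i.e. outside `obs`. -/
def LatentDirectedPath (E : N → N → Prop) (obs : Set N) (z t : N) : Prop :=
  ∃ (k : ℕ) (p : ℕ → N), 0 < k ∧ p 0 = z ∧ p k = t ∧ Set.InjOn p (Set.Iic k) ∧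
    (∀ i, i < k → E (p i) (p (i + 1))) ∧
    (∀ i, 0 < i → i < k → p i ∉ obs)

/-- There is a path between `z` and `t` (edges may be traversed in both directions) without
colliders, on which every vertex except `z` and `t` is latent, i.e. outside `obs`, and whose
first and last edge have an arrowhead pointing into `z` and into `t` respectively. -/
def LatentConfoundingPath (E : N → N → Prop) (obs : Set N) (z t : N) : Prop :=
  ∃ (k : ℕ) (p : ℕ → N), 0 < k ∧ p 0 = z ∧ p k = t ∧ Set.InjOn p (Set.Iic k) ∧
    (∀ i, i < k → E (p i) (p (i + 1)) ∨ E (p (i + 1)) (p i)) ∧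
    (∀ i, 0 < i → i < k → p i ∉ obs) ∧
    (∀ i, 0 < i → i < k → ¬ (E (p (i - 1)) (p i) ∧ E (p (i + 1)) (p i))) ∧
    E (p 1) (p 0) ∧ E (p (k - 1)) (p k)

theorem LatentConfoundingPath.symm {E : N → N → Prop} {obs : Set N} {z t : N}
    (h : LatentConfoundingPath E obs z t) : LatentConfoundingPath E obs t z := by
  obtain ⟨k, p, hk, h0, h1, hinj, hE, hobs, hcol, ha, hb⟩ := h
  refine ⟨k, fun i => p (k - i), hk, by simpa using h1, by simpa using h0, ?_, ?_, ?_, ?_, ?_, ?_⟩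
  · intro i hi j hj hij
    simp only [Set.mem_Iic] at hi hj
    have := hinj (Set.mem_Iic.2 (Nat.sub_le k i)) (Set.mem_Iic.2 (Nat.sub_le k j)) hij
    omega
  · intro i hi
    have := hE (k - (i + 1)) (by omega)
    rw [show k - (i + 1) + 1 = k - i by omega] at this
    exact this.symm
  · intro i h0 h1
    exact hobs (k - i) (by omega) (by omega)
  · intro i h0 h1 h
    refine hcol (k - i) (by omega) (by omega) ⟨?_, ?_⟩
    · rw [show k - i - 1 = k - (i + 1) by omega]
      exact h.2
    · rw [show k - i + 1 = k - (i - 1) by omega]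
      exact h.1
  · simpa using hb
  · show E (p (k - (k - 1))) (p (k - k))
    rw [show k - (k - 1) = 1 by omega, Nat.sub_self]
    exact ha

end Paths

namespace SMG

variable {α : Type u}

/-- The ancestors of `Y` in `G`, including the elements of `Y` themselves. -/
def An (G : SMG α) (Y : Set α) : Set α :=
  {a | a ∈ G.verts ∧ ∃ b ∈ Y, Relation.ReflTransGen G.dir a b}

theorem An_subset (G : SMG α) (Y : Set α) : G.An Y ⊆ G.verts := fun _ h => h.1

/-- The subgraph `G[A]` induced by `A`; it retains all directed and bidirected edges
between vertices in `A`. -/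
def induce (G : SMG α) (A : Set α) (hA : A ⊆ G.verts) : SMG α where
  verts := A
  finite_verts := G.finite_verts.subset hA
  dir a b := a ∈ A ∧ b ∈ A ∧ G.dir a b
  bidir a b := a ∈ A ∧ b ∈ A ∧ G.bidir a b
  dir_mem _ _ h := ⟨h.1, h.2.1⟩
  bidir_mem _ _ h := ⟨h.1, h.2.1⟩
  bidir_symm a b h := ⟨h.2.1, h.1, G.bidir_symm a b h.2.2⟩
  bidir_irrefl a h := G.bidir_irrefl a h.2.2
  acyclic a h := by
    have key : ∀ b, Relation.TransGen (fun a b => a ∈ A ∧ b ∈ A ∧ G.dir a b) a b →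
        Relation.TransGen G.dir a b := by
      intro b hb
      induction hb with
      | single h => exact Relation.TransGen.single h.2.2
      | tail _ h ih => exact ih.tail h.2.2
    exact G.acyclic a (key a h)

/-- The edges of the DAG underlying an SMG: its nodes are the observed vertices and one
unobserved parentless vertex for each unordered pair joined by a bidirected edge. -/
def dagEdge (G : SMG α) : α ⊕ Sym2 α → α ⊕ Sym2 α → Prop
  | Sum.inl a, Sum.inl b => G.dir a b
  | Sum.inr e, Sum.inl c => ∃ a b, e = s(a, b) ∧ G.bidir a b ∧ (c = a ∨ c = b)
  | _, Sum.inr _ => False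

theorem transGen_dagEdge (G : SMG α) {p q : α ⊕ Sym2 α}
    (h : Relation.TransGen G.dagEdge p q) (a : α) (hp : p = Sum.inl a) :
    ∃ b, q = Sum.inl b ∧ Relation.TransGen G.dir a b := by
  subst hp
  induction h with
  | @single q h =>
    cases q with
    | inl b => exact ⟨b, rfl, Relation.TransGen.single h⟩
    | inr e => exact h.elim
  | @tail q r _ h ih =>
    obtain ⟨b, rfl, hb⟩ := ih
    cases r with
    | inl c => exact ⟨c, rfl, hb.tail h⟩
    | inr e => exact h.elim

theorem transGen_of_latentDirectedPath {N : Type u} {E : N → N → Prop} {obs : Set N} {z t : N}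
    (h : LatentDirectedPath E obs z t) : Relation.TransGen E z t := by
  obtain ⟨k, p, hk, rfl, rfl, -, hE, -⟩ := h
  have key : ∀ j, j < k → Relation.TransGen E (p 0) (p (j + 1)) := by
    intro j
    induction j with
    | zero => exact fun hj => Relation.TransGen.single (hE 0 hj)
    | succ j ih => exact fun hj => (ih (by omega)).tail (hE (j + 1) hj)
  obtain ⟨m, rfl⟩ : ∃ m, k = m + 1 := ⟨k - 1, by omega⟩
  exact key m (by omega)

/-- The latent projection `L(G, A)`: the vertices outside `A`, together with the unobserved
vertices behind the bidirected edges of `G`, are regarded as latent. -/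
def latentProjection (G : SMG α) (A : Set α) (hA : A ⊆ G.verts) : SMG α where
  verts := A
  finite_verts := G.finite_verts.subset hA
  dir a b := a ∈ A ∧ b ∈ A ∧ a ≠ b ∧
    LatentDirectedPath G.dagEdge (Sum.inl '' A) (Sum.inl a) (Sum.inl b)
  bidir a b := a ∈ A ∧ b ∈ A ∧ a ≠ b ∧
    LatentConfoundingPath G.dagEdge (Sum.inl '' A) (Sum.inl a) (Sum.inl b)
  dir_mem _ _ h := ⟨h.1, h.2.1⟩
  bidir_mem _ _ h := ⟨h.1, h.2.1⟩
  bidir_symm _ _ h := ⟨h.2.1, h.1, h.2.2.1.symm, h.2.2.2.symm⟩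
  bidir_irrefl _ h := h.2.2.1 rfl
  acyclic a h := by
    have key : ∀ b, Relation.TransGen (fun a b => a ∈ A ∧ b ∈ A ∧ a ≠ b ∧
        LatentDirectedPath G.dagEdge (Sum.inl '' A) (Sum.inl a) (Sum.inl b)) a b →
        Relation.TransGen G.dir a b := by
      intro b hb
      have step : ∀ c d, LatentDirectedPath G.dagEdge (Sum.inl '' A) (Sum.inl c) (Sum.inl d) →
          Relation.TransGen G.dir c d := by
        intro c d hcd
        obtain ⟨e, he, hce⟩ :=
          G.transGen_dagEdge (transGen_of_latentDirectedPath hcd) c rfl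
        cases he
        exact hce
      induction hb with
      | single h => exact step _ _ h.2.2.2
      | tail _ h ih => exact ih.trans (step _ _ h.2.2.2)
    exact G.acyclic a (key a h)

/-- The graph `L(G[An(Y)], An(Y) \ {W})`. -/
abbrev ancestralProjection (G : SMG α) (Y : Set α) (W : α) : SMG α :=
  (G.induce (G.An Y) (G.An_subset Y)).latentProjection (G.An Y \ {W})
    (fun _ h => h.1)

end SMG

/-- A probabilistic causal model with graph `G`, in which the observed variable `a` takes its
values in `S a`. The unobserved variables are indexed by `U`, the `i`-th one has values in `D i`,
`P` is their joint distribution, and they are mutually independent. `ch i` is the set of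
observed variables in whose functions the `i`-th unobserved variable occurs; two distinct observed
variables may share an unobserved argument only if they are joined by a bidirected edge of `G`.
The value of `a` is given by `f a` in terms of its unobserved arguments and of its observed
parents in `G`. Semi-Markovian models are the ones in which every `ch i` has at most two elements;
a model with larger sets `ch i` has `G` as the latent projection of its diagram. A function is
allowed to ignore some of its arguments. -/
structure CausalModel {α : Type u} (G : SMG α) (S : α → Type v) where
  U : Type w
  D : U → Type w
  [measurableSpace : ∀ i, MeasurableSpace (D i)]
  P : Measure (∀ i, D i)
  [isProbabilityMeasure : IsProbabilityMeasure P]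
  indep : iIndepFun (fun (i : U) (d : ∀ i, D i) => d i) P
  ch : U → Set α
  bidir_of_mem_ch : ∀ i a b, a ∈ ch i → b ∈ ch i → a ∈ G.verts → b ∈ G.verts → a ≠ b → G.bidir a b
  f : ∀ a : G.verts, (∀ i : {i : U // (a : α) ∈ ch i}, D i) →
    (∀ b : {b : α // G.dir b a}, S b) → S a
  measurable_f : ∀ (a : G.verts) (s : ∀ b : {b : α // G.dir b a}, S b) (t : S a),
    MeasurableSet {d | f a d s = t}

namespace CausalModel

variable {α : Type u} {G : SMG α} {S : α → Type v}

open Classical in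
/-- `s` is the tuple of values of the observed variables in the submodel `M_x`, in which the
functions of the variables in `X` are replaced by the constants `x`, when the unobserved
variables have the values `d`. -/
def IsSolution (M : CausalModel.{u, v, w} G S) (X : Set α) (x : ∀ a : X, S a)
    (d : ∀ i, M.D i) (s : ∀ a : G.verts, S a) : Prop :=
  ∀ a : G.verts, s a =
    if h : (a : α) ∈ X then x ⟨a, h⟩
    else M.f a (fun i => d i) (fun b => s ⟨b, (G.dir_mem b a b.2).1⟩)

/-- In every submodel the unobserved variables determine the observed ones. -/
theorem existsUnique_isSolution (M : CausalModel.{u, v, w} G S) (X : Set α) (x : ∀ a : X, S a)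
    (d : ∀ i, M.D i) : ∃! s : ∀ a : G.verts, S a, M.IsSolution X x d s := by
  classical
  have hfin : Finite G.verts := G.finite_verts
  let r : G.verts → G.verts → Prop := fun a b => G.dir a b
  have hlift : ∀ a b : G.verts, Relation.TransGen r a b → Relation.TransGen G.dir a b :=
    fun a b h => by
      induction h with
      | single h => exact Relation.TransGen.single h
      | tail _ h ih => exact ih.tail h
  have hirr : Std.Irrefl (Relation.TransGen r) := ⟨fun a h => G.acyclic a (hlift a a h)⟩
  have hwf : WellFounded r :=
    Subrelation.wf (fun h => Relation.TransGen.single h)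
      (Finite.wellFounded_of_trans_of_irrefl (Relation.TransGen r))
  let F : ∀ a : G.verts, (∀ b : G.verts, r b a → S b) → S a := fun a ih =>
    if h : (a : α) ∈ X then x ⟨a, h⟩
    else M.f a (fun i => d i) (fun b => ih ⟨b, (G.dir_mem b a b.2).1⟩ b.2)
  refine ⟨fun a => hwf.fix F a, fun a => hwf.fix_eq F a, ?_⟩
  intro s hs
  funext a
  induction a using hwf.induction with
  | _ a ih =>
    rw [hs a, hwf.fix_eq F a]
    by_cases h : (a : α) ∈ X
    · simp only [F, h, dif_pos]
    · simp only [F, h, dif_neg, not_false_eq_true]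
      congr 1
      funext b
      exact ih ⟨b, (G.dir_mem b a b.2).1⟩ b.2

/-- The interventional probability `P_x(y)`: the probability that the variables in `Y` take the
values `y` in the submodel `M_x`. -/
noncomputable def doProb (M : CausalModel.{u, v, w} G S) (X : Set α) (x : ∀ a : X, S a)
    (Y : Set α) (y : ∀ a : Y, S a) : ℝ :=
  letI := M.measurableSpace
  M.P.real {d | ∃ s, M.IsSolution X x d s ∧
    ∀ (a : α) (ha : a ∈ G.verts) (hY : a ∈ Y), s ⟨a, ha⟩ = y ⟨a, hY⟩}

/-- The observational distribution `P(A)` of the variables in `A` (no intervention), given by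
its probability mass function. -/
noncomputable def prob (M : CausalModel.{u, v, w} G S) (A : Set α) (a : ∀ b : A, S b) : ℝ :=
  M.doProb ∅ (fun b => b.2.elim) A a

end CausalModel

section Identification

variable {α : Type u} {S : α → Type v}

/-- `P_x(y)` is identifiable in `G`: it is uniquely determined by the joint distribution of the
observed variables, among all models with graph `G` whose joint distribution is positive. -/
def Identifiable (G : SMG α) (X : Set α) (x : ∀ a : X, S a) (Y : Set α) (y : ∀ a : Y, S a) :
    Prop :=
  ∀ M₁ M₂ : CausalModel.{u, v, w} G S, (∀ a, 0 < M₁.prob G.verts a) →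
    M₁.prob G.verts = M₂.prob G.verts → M₁.doProb X x Y y = M₂.doProb X x Y y

/-- The number `q` is the value of `P_x(y)` obtained from the joint distribution `P` in `G`: `P`
is the joint distribution of some model with graph `G`, and all such models have
`P_x(y) = q`. -/
def IsEffectObtainedFrom (G : SMG α) (P : (∀ a : G.verts, S a) → ℝ)
    (X : Set α) (x : ∀ a : X, S a) (Y : Set α) (y : ∀ a : Y, S a) (q : ℝ) : Prop :=
  (∃ M : CausalModel.{u, v, w} G S, M.prob G.verts = P) ∧
    ∀ M : CausalModel.{u, v, w} G S, M.prob G.verts = P → M.doProb X x Y y = q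

end Identification

namespace SMG

variable {α : Type u}

/-! Identification rests on c-factors: `cFactor A v` is the probability that the functions of `A`
agree with `v`. It factors over sets not joined by bidirected edges (`cFactor_union`), and a vertex
without children in the set can be summed out (`cFactor_eq_tsum_update`). Let `C` be the bidirected
component of `X`. By `cFactor_inter_congr`, a positive joint distribution determines the factors of
`C` and of its complement. Since `X` has no child in `C`, summing `X` out of the first gives the
factor of `C \ {X}`. The product of that with the second is the truncated factorization of the
intervened distribution.

For the transfer between graphs, substituting the function of `W` into its children and dropping the
non-ancestors of `Y` turns a model of `G` into a model of the projection on the same probability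
space. Its solutions are restrictions of the old ones, so the marginal and the effect are unchanged.
Identifiability in the projection therefore gives both claims, and positivity is needed only for the
marginal. -/

theorem dir_irrefl (G : SMG α) (a : α) : ¬ G.dir a a :=
  fun h => G.acyclic a (Relation.TransGen.single h)

/-- Every nonempty set of vertices contains a vertex without children in that set. -/
theorem exists_sink (G : SMG α) {A : Set G.verts} (hA : A.Nonempty) :
    ∃ n ∈ A, ∀ a ∈ A, ¬ G.dir n a := by
  have hfin : Finite G.verts := G.finite_verts
  let r : G.verts → G.verts → Prop := fun a b => Relation.TransGen G.dir b a
  have : IsTrans G.verts r := ⟨fun _ _ _ h h' => Relation.TransGen.trans h' h⟩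
  have : Std.Irrefl r := ⟨fun a => G.acyclic a⟩
  obtain ⟨n, hn, hmin⟩ := (Finite.wellFounded_of_trans_of_irrefl r).has_min A hA
  exact ⟨n, hn, fun a ha h => hmin a ha (Relation.TransGen.single h)⟩

end SMG

/-! ### c-factors: factorization, summation and identification -/

namespace CausalModel

attribute [instance] CausalModel.measurableSpace CausalModel.isProbabilityMeasure

variable {α : Type u} {G : SMG α} {S : α → Type v}

/-- The event that the functions of the variables in `A` return the values `v`, when their observed
arguments have the values `v`. -/
def localEvent (M : CausalModel.{u, v, w} G S) (A : Set G.verts) (v : ∀ a : G.verts, S a) :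
    Set (∀ i, M.D i) :=
  {d | ∀ a ∈ A, M.f a (fun i => d i) (fun b => v ⟨b, (G.dir_mem b a b.2).1⟩) = v a}

/-- The probability of `localEvent`; for a union of confounded components this is the
corresponding c-factor. -/
noncomputable def cFactor (M : CausalModel.{u, v, w} G S) (A : Set G.verts)
    (v : ∀ a : G.verts, S a) : ℝ :=
  M.P.real (M.localEvent A v)

/-- The event depends only on unobserved variables occurring in functions of `A`. Measurability for
the σ-algebra they generate is what independence of two such blocks requires. -/
theorem measurableSet_localEvent_iSup (M : CausalModel.{u, v, w} G S) (A : Set G.verts)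
    (v : ∀ a : G.verts, S a) :
    MeasurableSet[⨆ i ∈ {i | ∃ a ∈ A, (a : α) ∈ M.ch i},
      MeasurableSpace.comap (fun d : ∀ i, M.D i => d i) (M.measurableSpace i)]
      (M.localEvent A v) := by
  have hfin : Finite G.verts := G.finite_verts
  have hset : M.localEvent A v = ⋂ a ∈ A, (fun (d : ∀ i, M.D i)
      (i : {i : M.U // (a : α) ∈ M.ch i}) => d i) ⁻¹'
        {d | M.f a d (fun b => v ⟨b, (G.dir_mem b a b.2).1⟩) = v a} := by
    ext d
    simp [localEvent]
  rw [hset]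
  refine MeasurableSet.biInter A.to_countable fun a ha => ?_
  refine Measurable.mono (ma := ⨆ i ∈ {i | ∃ a ∈ A, (a : α) ∈ M.ch i},
      MeasurableSpace.comap (fun d : ∀ i, M.D i => d i) (M.measurableSpace i))
    (mb := MeasurableSpace.pi) ?_ le_rfl le_rfl (M.measurable_f a _ _)
  refine @measurable_pi_lambda _ _ _ (_) _ _ fun i => ?_
  refine Measurable.mono (comap_measurable (fun d : ∀ i, M.D i => d i)) ?_ le_rfl
  exact le_iSup₂_of_le (f := fun i (_ : i ∈ {i | ∃ a ∈ A, (a : α) ∈ M.ch i}) =>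
    MeasurableSpace.comap (fun d : ∀ i, M.D i => d i) (M.measurableSpace i))
    (i : M.U) ⟨a, ha, i.2⟩ le_rfl

theorem measurableSet_localEvent (M : CausalModel.{u, v, w} G S) (A : Set G.verts)
    (v : ∀ a : G.verts, S a) : MeasurableSet (M.localEvent A v) :=
  iSup₂_le (fun i _ => (measurable_pi_apply i).comap_le) _ (M.measurableSet_localEvent_iSup A v)

theorem localEvent_anti (M : CausalModel.{u, v, w} G S) {A B : Set G.verts} (h : A ⊆ B)
    (v : ∀ a : G.verts, S a) : M.localEvent B v ⊆ M.localEvent A v :=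
  fun _ hd a ha => hd a (h ha)

theorem cFactor_anti (M : CausalModel.{u, v, w} G S) {A B : Set G.verts} (h : A ⊆ B)
    (v : ∀ a : G.verts, S a) : M.cFactor B v ≤ M.cFactor A v :=
  measureReal_mono (M.localEvent_anti h v)

/-- Factorization over sets of variables that are not joined by bidirected edges. -/
theorem cFactor_union (M : CausalModel.{u, v, w} G S) {A B : Set G.verts}
    (hAB : Disjoint A B) (h : ∀ a ∈ A, ∀ b ∈ B, ¬ G.bidir a b) (v : ∀ a : G.verts, S a) :
    M.cFactor (A ∪ B) v = M.cFactor A v * M.cFactor B v := by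
  have hdisj : Disjoint {i | ∃ a ∈ A, (a : α) ∈ M.ch i} {i | ∃ b ∈ B, (b : α) ∈ M.ch i} := by
    rw [Set.disjoint_left]
    rintro i ⟨a, ha, hai⟩ ⟨b, hb, hbi⟩
    refine h a ha b hb (M.bidir_of_mem_ch i a b hai hbi a.2 b.2 fun hab => ?_)
    exact Set.disjoint_left.1 hAB ha (Subtype.ext hab ▸ hb)
  have hind := indep_iSup_of_disjoint (μ := M.P)
    (fun i => (measurable_pi_apply (X := M.D) i).comap_le) M.indep hdisj
  have hunion : M.localEvent (A ∪ B) v = M.localEvent A v ∩ M.localEvent B v := by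
    ext d
    simp [localEvent, or_imp, forall_and]
  have := (Indep_iff _ _ M.P).1 hind _ _ (M.measurableSet_localEvent_iSup A v)
    (M.measurableSet_localEvent_iSup B v)
  simp only [cFactor, measureReal_def, hunion, this, ENNReal.toReal_mul]

theorem measureReal_iUnion_eq_tsum {Ω ι : Type*} [MeasurableSpace Ω] [Countable ι]
    (μ : Measure Ω) [IsFiniteMeasure μ] {E : ι → Set Ω}
    (hd : Pairwise (Function.onFun Disjoint E)) (hm : ∀ i, MeasurableSet (E i)) :
    μ.real (⋃ i, E i) = ∑' i, μ.real (E i) := by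
  simp only [measureReal_def, measure_iUnion hd hm]
  exact ENNReal.tsum_toReal_eq fun i => measure_ne_top μ _

open Classical in
/-- Summing out a variable that is not a parent of any variable in `A`. -/
theorem cFactor_eq_tsum_update [∀ a, Countable (S a)] (M : CausalModel.{u, v, w} G S)
    {A : Set G.verts} {n : G.verts} (hn : n ∉ A) (hpa : ∀ a ∈ A, ¬ G.dir n a)
    (v : ∀ a : G.verts, S a) :
    M.cFactor A v = ∑' t : S n, M.cFactor (insert n A) (Function.update v n t) := by
  have hmem : ∀ (t : S n) (d : ∀ i, M.D i),
      d ∈ M.localEvent (insert n A) (Function.update v n t) ↔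
        M.f n (fun i => d i) (fun b => v ⟨b, (G.dir_mem b n b.2).1⟩) = t ∧
          d ∈ M.localEvent A v := by
    intro t d
    -- The coordinate `n` is no argument of the functions in `insert n A`, so changing it to `t`
    -- affects only the value required of `n`.
    have hupd : ∀ a : G.verts, ¬ G.dir n a →
        (fun b : {b : α // G.dir b a} =>
          Function.update v n t ⟨b, (G.dir_mem b a b.2).1⟩) =
        fun b : {b : α // G.dir b a} => v ⟨b, (G.dir_mem b a b.2).1⟩ := by
      intro a ha
      funext b
      refine Function.update_of_ne (fun hb => ha ?_) _ _
      rw [← hb]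
      exact b.2
    simp only [localEvent, Set.mem_ofPred_eq, Set.forall_mem_insert]
    refine and_congr ?_ (forall₂_congr fun a ha => ?_)
    · rw [hupd n (G.dir_irrefl n), Function.update_self]
    · rw [hupd a (hpa a ha), Function.update_of_ne (ne_of_mem_of_not_mem ha hn)]
  have hset : M.localEvent A v =
      ⋃ t : S n, M.localEvent (insert n A) (Function.update v n t) := by
    ext d
    simp only [Set.mem_iUnion, hmem, exists_eq_left']
  simp only [cFactor]
  rw [hset, measureReal_iUnion_eq_tsum _ _ fun t => M.measurableSet_localEvent _ _]
  intro t t' htt'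
  refine Set.disjoint_left.2 fun d hd hd' => htt' ?_
  rw [← ((hmem t d).1 hd).1, ((hmem t' d).1 hd').1]

theorem isSolution_iff (M : CausalModel.{u, v, w} G S) (X : Set α) (x : ∀ a : X, S a)
    (d : ∀ i, M.D i) (s : ∀ a : G.verts, S a) :
    M.IsSolution X x d s ↔ (∀ (a : G.verts) (h : (a : α) ∈ X), s a = x ⟨a, h⟩) ∧
      d ∈ M.localEvent {a | (a : α) ∉ X} s := by
  constructor
  · intro h
    refine ⟨fun a ha => ?_, fun a ha => ?_⟩
    · rw [h a, dif_pos ha]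
    · rw [h a, dif_neg ha]
  · rintro ⟨h, h'⟩ a
    by_cases ha : (a : α) ∈ X
    · rw [dif_pos ha, h a ha]
    · rw [dif_neg ha, h' a ha]

theorem prob_verts (M : CausalModel.{u, v, w} G S) (v : ∀ a : G.verts, S a) :
    M.prob G.verts v = M.cFactor Set.univ v := by
  unfold prob doProb cFactor
  congr 1
  ext d
  simp only [Set.mem_ofPred_eq, isSolution_iff]
  constructor
  · rintro ⟨s, hs, h⟩
    obtain rfl : s = v := funext fun a => h a a.2 a.2
    simpa using hs.2
  · intro h
    exact ⟨v, ⟨fun _ h => h.elim, by simpa using h⟩, fun _ _ _ => rfl⟩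

open Classical in
/-- The truncated factorization of interventional probabilities. -/
theorem doProb_eq_tsum [∀ a, Countable (S a)] (M : CausalModel.{u, v, w} G S) (X : Set α)
    (x : ∀ a : X, S a) (Y : Set α) (y : ∀ a : Y, S a) :
    M.doProb X x Y y = ∑' s : ∀ a : G.verts, S a,
      if (∀ (a : G.verts) (h : (a : α) ∈ X), s a = x ⟨a, h⟩) ∧
        (∀ (a : α) (ha : a ∈ G.verts) (hY : a ∈ Y), s ⟨a, ha⟩ = y ⟨a, hY⟩)
      then M.cFactor {a | (a : α) ∉ X} s else 0 := by
  have hfin : Finite G.verts := G.finite_verts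
  have hset : {d | ∃ s, M.IsSolution X x d s ∧
      ∀ (a : α) (ha : a ∈ G.verts) (hY : a ∈ Y), s ⟨a, ha⟩ = y ⟨a, hY⟩} =
      ⋃ s : ∀ a : G.verts, S a,
      if (∀ (a : G.verts) (h : (a : α) ∈ X), s a = x ⟨a, h⟩) ∧
        (∀ (a : α) (ha : a ∈ G.verts) (hY : a ∈ Y), s ⟨a, ha⟩ = y ⟨a, hY⟩)
      then M.localEvent {a | (a : α) ∉ X} s else ∅ := by
    ext d
    simp only [Set.mem_ofPred_eq, Set.mem_iUnion, isSolution_iff]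
    refine exists_congr fun s => ?_
    split_ifs with h
    · tauto
    · simp only [Set.mem_empty_iff_false, iff_false]
      tauto
  unfold doProb
  rw [hset, measureReal_iUnion_eq_tsum]
  · refine tsum_congr fun s => ?_
    split_ifs
    · rfl
    · simp
  · intro s s' hss'
    refine Set.disjoint_left.2 fun d hd hd' => hss' ?_
    beta_reduce at hd hd'
    split_ifs at hd with h
    · split_ifs at hd' with h'
      · exact (M.existsUnique_isSolution X x d).unique
          ((M.isSolution_iff X x d s).2 ⟨h.1, hd⟩) ((M.isSolution_iff X x d s').2 ⟨h'.1, hd'⟩)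
      · exact hd'.elim
    · exact hd.elim
  · intro s
    split_ifs
    · exact M.measurableSet_localEvent _ _
    · exact MeasurableSet.empty

/-- Marginals are determined by the joint distribution. -/
theorem prob_congr [∀ a, Countable (S a)] {M₁ M₂ : CausalModel.{u, v, w} G S}
    (h : M₁.prob G.verts = M₂.prob G.verts) (A : Set α) : M₁.prob A = M₂.prob A := by
  classical
  funext a
  unfold prob
  rw [doProb_eq_tsum, doProb_eq_tsum]
  refine tsum_congr fun s => ?_
  have huniv : {a : G.verts | (a : α) ∉ (∅ : Set α)} = Set.univ := by simp
  rw [huniv, ← prob_verts, ← prob_verts, h]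

/-- The c-factors of the two parts of a set of variables, divided by a set `C` that is closed
under bidirected edges, are determined by the positive factor of the whole set. -/
theorem cFactor_inter_congr [∀ a, Countable (S a)] {M₁ M₂ : CausalModel.{u, v, w} G S}
    (hpos₁ : ∀ A v, 0 < M₁.cFactor A v)
    {C : Set G.verts} (hC : ∀ a ∈ C, ∀ b ∉ C, ¬ G.bidir a b) (A : Set G.verts)
    (h : M₁.cFactor A = M₂.cFactor A) :
    M₁.cFactor (A ∩ C) = M₂.cFactor (A ∩ C) ∧ M₁.cFactor (A \ C) = M₂.cFactor (A \ C) := by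
  classical
  have hfin : Finite G.verts := G.finite_verts
  have hfac : ∀ (M : CausalModel.{u, v, w} G S) (A : Set G.verts) v,
      M.cFactor A v = M.cFactor (A ∩ C) v * M.cFactor (A \ C) v := by
    intro M A v
    rw [← M.cFactor_union (Set.disjoint_sdiff_right.mono_left Set.inter_subset_right)
      (fun a ha b hb => hC a ha.2 b hb.2), Set.inter_union_sdiff]
  induction hk : A.ncard generalizing A with
  | zero =>
    obtain rfl : A = ∅ := (Set.ncard_eq_zero A.toFinite).1 hk
    simpa using h
  | succ k ih =>
    -- Summing out a sink `n` preserves agreement of the two models. The part of `A` not containing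
    -- `n` is unaffected by its removal, so induction settles that part; dividing the factor of `A`
    -- by it settles the other.
    obtain ⟨n, hn, hsink⟩ := G.exists_sink (A := A) (Set.nonempty_of_ncard_ne_zero (by omega))
    have hnA : n ∉ A \ {n} := fun h => h.2 rfl
    have hsum : ∀ M : CausalModel.{u, v, w} G S, ∀ v, M.cFactor (A \ {n}) v =
        ∑' t : S n, M.cFactor A (Function.update v n t) := by
      intro M v
      rw [M.cFactor_eq_tsum_update hnA (fun a ha => hsink a ha.1) v,
        Set.insert_sdiff_singleton, Set.insert_eq_of_mem hn]
    obtain ⟨h₁, h₂⟩ := ih (A \ {n}) (funext fun v => by rw [hsum, hsum, h])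
      (by rw [Set.ncard_sdiff_singleton_of_mem hn, hk]; rfl)
    by_cases hnC : n ∈ C
    · have hD : (A \ {n}) \ C = A \ C := by
        ext a
        simp only [Set.mem_sdiff, Set.mem_singleton_iff]
        refine ⟨fun h => ⟨h.1.1, h.2⟩, fun h => ⟨⟨h.1, ?_⟩, h.2⟩⟩
        rintro rfl
        exact h.2 hnC
      rw [hD] at h₂
      refine ⟨funext fun v => mul_right_cancel₀ (hpos₁ (A \ C) v).ne' ?_, h₂⟩
      rw [← hfac, h, hfac, h₂]
    · have hD : (A \ {n}) ∩ C = A ∩ C := by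
        ext a
        simp only [Set.mem_sdiff, Set.mem_inter_iff, Set.mem_singleton_iff]
        refine ⟨fun h => ⟨h.1.1, h.2⟩, fun h => ⟨⟨h.1, ?_⟩, h.2⟩⟩
        rintro rfl
        exact hnC h.2
      rw [hD] at h₁
      refine ⟨h₁, funext fun v => mul_left_cancel₀ (hpos₁ (A ∩ C) v).ne' ?_⟩
      rw [← hfac, h, hfac, h₁]

end CausalModel

/-! ### The identifiability criterion -/

/-- The effects of `X` are identifiable if no child of `X` is joined to `X` by a path of
bidirected edges. -/
theorem identifiable_of_forall_dir_not_transGen_bidir {α : Type u} {S : α → Type v}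
    [∀ a, Countable (S a)] (G : SMG α) {X : α} (hX : X ∈ G.verts)
    (hpath : ∀ C, G.dir X C → ¬ Relation.TransGen G.bidir X C)
    (x : ∀ a : ({X} : Set α), S a) (Y : Set α) (y : ∀ a : Y, S a) :
    Identifiable.{u, v, w} G {X} x Y y := by
  classical
  intro M₁ M₂ hpos h
  let C : Set G.verts := {a | Relation.ReflTransGen G.bidir X a}
  let X' : G.verts := ⟨X, hX⟩
  have hXC : X' ∈ C := Relation.ReflTransGen.refl
  have hC : ∀ a ∈ C, ∀ b ∉ C, ¬ G.bidir a b := fun a ha b hb hab => hb (ha.tail hab)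
  have hchild : ∀ a ∈ C \ {X'}, ¬ G.dir X a := by
    rintro a ⟨ha, hne⟩ hdir
    rcases Relation.reflTransGen_iff_eq_or_transGen.1 ha with heq | htr
    · exact hne (Subtype.ext heq)
    · exact hpath a hdir htr
  have huniv : M₁.cFactor Set.univ = M₂.cFactor Set.univ := by
    funext v
    rw [← CausalModel.prob_verts, ← CausalModel.prob_verts, h]
  -- Fewer equations give a larger event, so every factor inherits positivity from the joint
  -- distribution.
  have hpos₁ : ∀ A v, 0 < M₁.cFactor A v := fun A v =>
    (M₁.prob_verts v ▸ hpos v : 0 < M₁.cFactor Set.univ v).trans_le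
      (M₁.cFactor_anti (Set.subset_univ A) v)
  obtain ⟨h₁, h₂⟩ := CausalModel.cFactor_inter_congr hpos₁ hC Set.univ huniv
  rw [Set.univ_inter] at h₁
  have hsplit : {a : G.verts | (a : α) ∉ ({X} : Set α)} = (C \ {X'}) ∪ (Set.univ \ C) := by
    ext a
    have : (a : α) = X ↔ a = X' := (Subtype.ext_iff (a2 := X')).symm
    simp only [Set.mem_ofPred_eq, Set.mem_singleton_iff, this, Set.mem_union, Set.mem_sdiff,
      Set.mem_univ, true_and]
    constructor
    · tauto
    · rintro (h | h)
      · exact h.2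
      · rintro rfl
        exact h hXC
  have hfac : ∀ (M : CausalModel.{u, v, w} G S) v,
      M.cFactor {a : G.verts | (a : α) ∉ ({X} : Set α)} v =
        (∑' t : S X', M.cFactor C (Function.update v X' t)) * M.cFactor (Set.univ \ C) v := by
    intro M v
    rw [hsplit, M.cFactor_union (Set.disjoint_sdiff_right.mono_left Set.sdiff_subset)
      (fun a ha b hb => hC a ha.1 b hb.2),
      M.cFactor_eq_tsum_update (n := X') (fun h => h.2 rfl) hchild v,
      Set.insert_sdiff_singleton, Set.insert_eq_of_mem hXC]
  rw [CausalModel.doProb_eq_tsum, CausalModel.doProb_eq_tsum]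
  refine tsum_congr fun s => ?_
  rw [hfac, hfac, h₁, h₂]

/-! ### Short latent paths and edges of the projection -/

section LatentPaths

variable {N : Type u} {E : N → N → Prop} {obs : Set N}

theorem LatentDirectedPath.of_edge {z t : N} (h : E z t) (hzt : z ≠ t) :
    LatentDirectedPath E obs z t := by
  refine ⟨1, fun i => if i = 0 then z else t, one_pos, rfl, rfl, ?_, ?_, ?_⟩
  · intro i hi j hj hij
    simp only [Set.mem_Iic] at hi hj
    interval_cases i <;> interval_cases j <;> simp_all
  · intro i hi
    interval_cases i
    simpa using h
  · intro i h0 h1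
    omega

theorem LatentDirectedPath.of_edge_edge {z m t : N} (h : E z m) (h' : E m t) (hm : m ∉ obs)
    (hzm : z ≠ m) (hmt : m ≠ t) (hzt : z ≠ t) : LatentDirectedPath E obs z t := by
  refine ⟨2, fun i => if i = 0 then z else if i = 1 then m else t, two_pos, rfl, rfl, ?_, ?_, ?_⟩
  · intro i hi j hj hij
    simp only [Set.mem_Iic] at hi hj
    interval_cases i <;> interval_cases j <;> simp_all
  · intro i hi
    interval_cases i <;> simpa
  · intro i h0 h1
    interval_cases i
    simpa using hm

theorem LatentConfoundingPath.of_common_parent {z m t : N} (h : E m z) (h' : E m t)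
    (hm : m ∉ obs) (hmz : ¬ E z m) (hzm : z ≠ m) (hmt : m ≠ t) (hzt : z ≠ t) :
    LatentConfoundingPath E obs z t := by
  refine ⟨2, fun i => if i = 0 then z else if i = 1 then m else t, two_pos, rfl, rfl,
    ?_, ?_, ?_, ?_, by simpa, by simpa⟩
  · intro i hi j hj hij
    simp only [Set.mem_Iic] at hi hj
    interval_cases i <;> interval_cases j <;> simp_all
  · intro i hi
    interval_cases i <;> simp [h, h']
  · intro i h0 h1
    interval_cases i
    simpa using hm
  · intro i h0 h1
    interval_cases i
    simp [hmz]

/-- On `z ← e → m → t`, `hze` and `htm` exclude the reversed edges that could make `e` or `m` a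
collider. -/
theorem LatentConfoundingPath.of_common_ancestor {z e m t : N} (h : E e z) (h' : E e m)
    (h'' : E m t) (he : e ∉ obs) (hm : m ∉ obs) (hze : ¬ E z e) (htm : ¬ E t m)
    (h₁ : z ≠ e) (h₂ : z ≠ m) (h₃ : z ≠ t) (h₄ : e ≠ m) (h₅ : e ≠ t) (h₆ : m ≠ t) :
    LatentConfoundingPath E obs z t := by
  refine ⟨3, fun i => if i = 0 then z else if i = 1 then e else if i = 2 then m else t,
    three_pos, rfl, rfl, ?_, ?_, ?_, ?_, by simpa, by simpa⟩
  · intro i hi j hj hij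
    simp only [Set.mem_Iic] at hi hj
    interval_cases i <;> interval_cases j <;> simp_all
  · intro i hi
    interval_cases i <;> simp [h, h', h'']
  · intro i h0 h1
    interval_cases i <;> simpa
  · intro i h0 h1
    interval_cases i <;> simp [hze, htm]

end LatentPaths

namespace SMG

variable {α : Type u} {G : SMG α} {Y : Set α} {W : α}

theorem mem_An_of_dir {a b : α} (h : G.dir a b) (hb : b ∈ G.An Y) : a ∈ G.An Y := by
  obtain ⟨-, c, hc, hbc⟩ := hb
  exact ⟨(G.dir_mem a b h).1, c, hc, Relation.ReflTransGen.head h hbc⟩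

theorem ne_of_dir {a b : α} (h : G.dir a b) : a ≠ b := by
  rintro rfl
  exact G.dir_irrefl a h

theorem not_dir_of_dir {a b : α} (h : G.dir a b) : ¬ G.dir b a :=
  fun h' => G.acyclic a ((Relation.TransGen.single h).tail h')

theorem ancestralProjection_dir {a b : α} (ha : a ≠ W) (hb : b ∈ G.An Y \ {W})
    (h : G.dir a b) : (G.ancestralProjection Y W).dir a b := by
  have haA := mem_An_of_dir h hb.1
  refine ⟨⟨haA, ha⟩, hb, ne_of_dir h, LatentDirectedPath.of_edge ?_ ?_⟩
  · exact ⟨haA, hb.1, h⟩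
  · simpa using ne_of_dir h

theorem ancestralProjection_dir_of_dir_dir {a b : α} (hb : b ∈ G.An Y \ {W})
    (h : G.dir a W) (h' : G.dir W b) : (G.ancestralProjection Y W).dir a b := by
  have hWA := mem_An_of_dir h' hb.1
  have haA := mem_An_of_dir h hWA
  have hab : a ≠ b := by
    rintro rfl
    exact not_dir_of_dir h h'
  refine ⟨⟨haA, ne_of_dir h⟩, hb, hab, LatentDirectedPath.of_edge_edge (m := Sum.inl W)
    ⟨haA, hWA, h⟩ ⟨hWA, hb.1, h'⟩ ?_ ?_ ?_ ?_⟩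
  · simp
  · simpa using ne_of_dir h
  · simpa using ne_of_dir h'
  · simpa using hab

theorem ancestralProjection_bidir {a b : α} (ha : a ∈ G.An Y \ {W}) (hb : b ∈ G.An Y \ {W})
    (hab : a ≠ b) (h : G.bidir a b) : (G.ancestralProjection Y W).bidir a b := by
  refine ⟨ha, hb, hab, LatentConfoundingPath.of_common_parent (m := Sum.inr s(a, b))
    ⟨a, b, rfl, ⟨ha.1, hb.1, h⟩, Or.inl rfl⟩ ⟨a, b, rfl, ⟨ha.1, hb.1, h⟩, Or.inr rfl⟩ ?_ ?_ ?_ ?_ ?_⟩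
  · simp
  · exact id
  · simp
  · simp
  · simpa using hab

theorem ancestralProjection_bidir_of_dir {a b : α} (ha : a ∈ G.An Y \ {W})
    (hb : b ∈ G.An Y \ {W}) (hab : a ≠ b) (h : G.dir W a) (h' : G.dir W b) :
    (G.ancestralProjection Y W).bidir a b := by
  have hWA := mem_An_of_dir h ha.1
  refine ⟨ha, hb, hab, LatentConfoundingPath.of_common_parent (m := Sum.inl W)
    ⟨hWA, ha.1, h⟩ ⟨hWA, hb.1, h'⟩ ?_ ?_ ?_ ?_ ?_⟩
  · simp
  · exact fun h'' => not_dir_of_dir h h''.2.2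
  · simpa using (ne_of_dir h).symm
  · simpa using ne_of_dir h'
  · simpa using hab

/-- The witness is `a ← s(a, W) → W → b`, through the unobserved parent behind `a ↔ W`. -/
theorem ancestralProjection_bidir_of_bidir_dir {a b : α} (ha : a ∈ G.An Y \ {W})
    (hb : b ∈ G.An Y \ {W}) (hab : a ≠ b) (h : G.bidir a W) (h' : G.dir W b) :
    (G.ancestralProjection Y W).bidir a b := by
  have hWA := mem_An_of_dir h' hb.1
  refine ⟨ha, hb, hab, LatentConfoundingPath.of_common_ancestor (e := Sum.inr s(a, W))
    (m := Sum.inl W) ⟨a, W, rfl, ⟨ha.1, hWA, h⟩, Or.inl rfl⟩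
    ⟨a, W, rfl, ⟨ha.1, hWA, h⟩, Or.inr rfl⟩ ⟨hWA, hb.1, h'⟩ ?_ ?_ ?_ ?_ ?_ ?_ ?_ ?_ ?_ ?_⟩
  · simp
  · simp
  · exact id
  · exact fun h'' => not_dir_of_dir h' h''.2.2
  · simp
  · simpa using ha.2
  · simpa using hab
  · simp
  · simp
  · simpa using ne_of_dir h'

end SMG

/-! ### Eliminating `W` from a model -/

namespace CausalModel

variable {α : Type u} {G : SMG α} {S : α → Type v}

/-- The value of `W` in terms of the unobserved variables and of the observed parents of a child
`a` of `W` in the latent projection. -/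
def eliminatedValue (M : CausalModel.{u, v, w} G S) {Y : Set α} {W : α} (a : α)
    (ha : a ∈ G.An Y \ {W}) (hWa : G.dir W a)
    (d : ∀ i : {i : M.U // a ∈ M.ch i ∨ G.dir W a ∧ W ∈ M.ch i}, M.D i)
    (s : ∀ b : {b : α // (G.ancestralProjection Y W).dir b a}, S b) : S W :=
  M.f ⟨W, (G.dir_mem W a hWa).1⟩ (fun i => d ⟨i, Or.inr ⟨hWa, i.2⟩⟩)
    (fun b => s ⟨b, SMG.ancestralProjection_dir_of_dir_dir ha b.2 hWa⟩)

open Classical in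
/-- The function of `a` after the function of `W` has been substituted for `W`. -/
noncomputable def projectedFun (M : CausalModel.{u, v, w} G S) {Y : Set α} {W : α} (a : α)
    (ha : a ∈ G.An Y \ {W})
    (d : ∀ i : {i : M.U // a ∈ M.ch i ∨ G.dir W a ∧ W ∈ M.ch i}, M.D i)
    (s : ∀ b : {b : α // (G.ancestralProjection Y W).dir b a}, S b) : S a :=
  M.f ⟨a, ha.1.1⟩ (fun i => d ⟨i, Or.inl i.2⟩) (fun b =>
    if hb : (b : α) = W then
      cast (congrArg S hb.symm) (M.eliminatedValue a ha (hb ▸ b.2) d s)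
    else s ⟨b, SMG.ancestralProjection_dir hb ha b.2⟩)

/-- The model induced on the ancestors of `Y` other than `W`, with the same unobserved
variables. -/
noncomputable def ancestralProjection [∀ a, Countable (S a)] (M : CausalModel.{u, v, w} G S) (Y : Set α)
    (W : α) : CausalModel.{u, v, w} (G.ancestralProjection Y W) S where
  U := M.U
  D := M.D
  P := M.P
  indep := M.indep
  -- The unobserved arguments of `W` pass to all its children, so this set can exceed two elements
  -- even if `M` is semi-Markovian.
  ch i := {a | a ∈ M.ch i ∨ G.dir W a ∧ W ∈ M.ch i}
  bidir_of_mem_ch i a b hai hbi ha hb hab := by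
    rcases hai with hai | ⟨hWa, hWi⟩ <;> rcases hbi with hbi | ⟨hWb, hWi'⟩
    · exact SMG.ancestralProjection_bidir ha hb hab
        (M.bidir_of_mem_ch i a b hai hbi ha.1.1 hb.1.1 hab)
    · exact SMG.ancestralProjection_bidir_of_bidir_dir ha hb hab
        (M.bidir_of_mem_ch i a W hai hWi' ha.1.1 (G.dir_mem _ _ hWb).1 ha.2) hWb
    · exact (G.ancestralProjection Y W).bidir_symm _ _
        (SMG.ancestralProjection_bidir_of_bidir_dir hb ha hab.symm
          (M.bidir_of_mem_ch i b W hbi hWi hb.1.1 (G.dir_mem _ _ hWa).1 hb.2) hWa)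
    · exact SMG.ancestralProjection_bidir_of_dir ha hb hab hWa hWb
  f a d s := M.projectedFun a a.2 d s
  measurable_f := by
    classical
    rintro ⟨a, ha⟩ s t
    have hmeas : ∀ r, MeasurableSet {d : ∀ i : {i : M.U // a ∈ M.ch i ∨ G.dir W a ∧ W ∈ M.ch i},
        M.D i | M.f ⟨a, ha.1.1⟩ (fun i => d ⟨i, Or.inl i.2⟩) r = t} := fun r =>
      (measurable_pi_lambda (fun (d : ∀ i : {i : M.U // a ∈ M.ch i ∨ G.dir W a ∧ W ∈ M.ch i},
        M.D i) (i : {i : M.U // a ∈ M.ch i}) => d ⟨i, Or.inl i.2⟩)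
        (fun i => measurable_pi_apply _)) (M.measurable_f ⟨a, ha.1.1⟩ r t)
    by_cases hWa : G.dir W a
    -- Measurability of `M.f` is given only for fixed observed arguments, hence the countable split
    -- over the value `z` of `W`.
    · have hset : {d | M.projectedFun a ha d s = t} = ⋃ z : S W,
          {d | M.eliminatedValue a ha hWa d s = z} ∩
          {d | M.f ⟨a, ha.1.1⟩ (fun i => d ⟨i, Or.inl i.2⟩) (fun b =>
            if hb : (b : α) = W then cast (congrArg S hb.symm) z
            else s ⟨b, SMG.ancestralProjection_dir hb ha b.2⟩) = t} := by
        ext d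
        simp only [Set.mem_ofPred_eq, Set.mem_iUnion, Set.mem_inter_iff, exists_eq_left']
        rfl
      have hm : MeasurableSet {d | M.projectedFun a ha d s = t} := by
        rw [hset]
        refine MeasurableSet.iUnion fun z => MeasurableSet.inter ?_ (hmeas _)
        exact (measurable_pi_lambda
          (fun (d : ∀ i : {i : M.U // a ∈ M.ch i ∨ G.dir W a ∧ W ∈ M.ch i}, M.D i)
            (i : {i : M.U // W ∈ M.ch i}) => d ⟨i, Or.inr ⟨hWa, i.2⟩⟩)
          (fun i => measurable_pi_apply _)) (M.measurable_f ⟨W, (G.dir_mem W a hWa).1⟩ _ z)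
      exact hm
    · have hne : ∀ b : {b : α // G.dir b a}, (b : α) ≠ W := fun b hb => hWa (hb ▸ b.2)
      have hset : {d | M.projectedFun a ha d s = t} =
          {d | M.f ⟨a, ha.1.1⟩ (fun i => d ⟨i, Or.inl i.2⟩)
            (fun b => s ⟨b, SMG.ancestralProjection_dir (hne b) ha b.2⟩) = t} := by
        ext d
        simp only [Set.mem_ofPred_eq, projectedFun, hne, dif_neg, not_false_eq_true]
      have hm : MeasurableSet {d | M.projectedFun a ha d s = t} := by
        rw [hset]
        exact hmeas _
      exact hm

variable [∀ a, Countable (S a)] (M : CausalModel.{u, v, w} G S) {Y : Set α} {W : α}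

/-- As `W` is not intervened on, its value in a solution is the one its function returns, so the
substitution changes nothing. -/
theorem IsSolution.ancestralProjection {M : CausalModel.{u, v, w} G S} {X : Set α}
    {x : ∀ a : X, S a} (hWX : W ∉ X) {d : ∀ i, M.D i} {s : ∀ a : G.verts, S a}
    (h : M.IsSolution X x d s) :
    (M.ancestralProjection Y W).IsSolution X x d (fun a => s ⟨a, a.2.1.1⟩) := by
  classical
  rintro ⟨a, ha⟩
  refine (h ⟨a, ha.1.1⟩).trans ?_
  refine dite_congr rfl (fun _ => rfl) fun _ => ?_
  change _ = M.projectedFun a ha (fun i => d i) (fun b => s ⟨b, b.2.1.1.1⟩)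
  unfold projectedFun
  congr 1
  funext ⟨b, hb⟩
  by_cases hbW : b = W
  · subst hbW
    rw [dif_pos rfl, h ⟨b, _⟩, dif_neg hWX]
    rfl
  · rw [dif_neg hbW]

/-- Solutions are unique in both models, so that of the projected model is the restriction of the
original one, and the two events coincide. -/
theorem doProb_ancestralProjection {X : Set α} (hWX : W ∉ X) (x : ∀ a : X, S a) {A : Set α}
    (hA : A ⊆ G.An Y \ {W}) (y : ∀ a : A, S a) :
    (M.ancestralProjection Y W).doProb X x A y = M.doProb X x A y := by
  unfold doProb
  refine congrArg M.P.real (Set.ext fun d => ?_)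
  constructor
  · rintro ⟨s', hs', hy⟩
    obtain ⟨s, hs, -⟩ := M.existsUnique_isSolution X x d
    obtain rfl := ((M.ancestralProjection Y W).existsUnique_isSolution X x d).unique hs'
      (hs.ancestralProjection hWX)
    exact ⟨s, hs, fun a _ haA => hy a (hA haA) haA⟩
  · rintro ⟨s, hs, hy⟩
    exact ⟨_, hs.ancestralProjection hWX, fun a ha haA => hy a ha.1.1 haA⟩

theorem prob_ancestralProjection :
    (M.ancestralProjection Y W).prob (G.ancestralProjection Y W).verts =
      M.prob (G.An Y \ {W}) :=
  funext fun a => M.doProb_ancestralProjection (fun h => h.elim) _ (A := G.An Y \ {W})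
    (fun _ h => h) a

end CausalModel

theorem mainTheorem7 {α : Type u} {S : α → Type v} [∀ a, Countable (S a)]
    (G : SMG α) (Y : Set α) (hY : Y ⊆ G.verts) (X W : α) (hXW : X ≠ W) (hWY : W ∉ Y)
    (hX : X ∈ G.An Y) (hW : W ∈ G.An Y)
    (hpath : ∀ C, (G.ancestralProjection Y W).dir X C →
      ¬ Relation.TransGen (G.ancestralProjection Y W).bidir X C)
    (x : ∀ a : ({X} : Set α), S a) (y : ∀ a : Y, S a) :
    Identifiable.{u, v, w} (G.ancestralProjection Y W) {X} x Y y ∧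
    ∀ M : CausalModel.{u, v, w} G S,
      (∀ a : (∀ b : (G.An Y \ {W} : Set α), S b), 0 < M.prob (G.An Y \ {W}) a) →
        IsEffectObtainedFrom.{u, v, w} G (M.prob G.verts) {X} x Y y
          (M.doProb {X} x Y y) ∧
        IsEffectObtainedFrom.{u, v, w} (G.ancestralProjection Y W) (M.prob (G.An Y \ {W}))
          {X} x Y y (M.doProb {X} x Y y) := by
  have hid : Identifiable.{u, v, w} (G.ancestralProjection Y W) {X} x Y y :=
    identifiable_of_forall_dir_not_transGen_bidir _ (show X ∈ G.An Y \ {W} from ⟨hX, hXW⟩) hpath x Y y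
  have hWX : W ∉ ({X} : Set α) := fun h => hXW h.symm
  have hYA : Y ⊆ G.An Y \ {W} := fun a ha =>
    ⟨⟨hY ha, a, ha, Relation.ReflTransGen.refl⟩, fun h => hWY (h ▸ ha)⟩
  refine ⟨hid, fun M hpos => ?_⟩
  have hpos' : ∀ a, 0 < (M.ancestralProjection Y W).prob (G.ancestralProjection Y W).verts a := by
    rw [M.prob_ancestralProjection]
    exact hpos
  have hdet : ∀ M' : CausalModel.{u, v, w} (G.ancestralProjection Y W) S,
      M'.prob (G.ancestralProjection Y W).verts = M.prob (G.An Y \ {W}) →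
      M'.doProb {X} x Y y = M.doProb {X} x Y y := by
    intro M' hM'
    rw [← M.doProb_ancestralProjection hWX x hYA y]
    exact (hid _ M' hpos' (M.prob_ancestralProjection.trans hM'.symm)).symm
  refine ⟨⟨⟨M, rfl⟩, fun M' hM' => ?_⟩, ⟨⟨_, M.prob_ancestralProjection⟩, hdet⟩⟩
  -- A competing model of `G` is projected too; equal joint distributions have equal marginals, so
  -- `hdet` applies to its projection.
  rw [← M'.doProb_ancestralProjection hWX x hYA y]
  exact hdet _ (M'.prob_ancestralProjection.trans (CausalModel.prob_congr hM' _))
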